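/- Let $G=(V,\mathcal E)$ be a finite connected graph with $n=|V|$ sites, with its graph distance $\mathrm{dist}$, such that $|\{j:\mathrm{dist}(i,j)\le s\}|\le\alpha s^d$ for every site $i$ and every integer $s\ge1$, where $d\ge1$ is an integer and $\alpha>0$ (for instance a box of the $d$-dimensional hypercubic lattice with the Manhattan distance). On each site sits a spin with $q\ge1$ levels, so that the Hilbert space is $(\mathbb C^q)^{\otimes V}$. Let $H=\sum_{i\in V}H_i$ and $\Omega=\sum_{i\in V}\Omega_i$ with $H_i,\Omega_i$ self-adjoint, $\|H_i\|\le1$ and $\|\Omega_i\|\le1$ in operator norm, where $H_i$ acts only on the spins at distance at most $\ell_0$ from $i$ and $\Omega_i$ only on those at distance at most $\ell$ from $i$. Here $\ell_0\ge 0$ and $\ell\ge1$ are integers. Let $\beta\ge0$ and $\rho_\beta=e^{-\beta H}/\mathrm{tr}\,e^{-\beta H}$, $\langle A\rangle_\beta=\mathrm{tr}(\rho_\beta A)$. Suppose that $\rho_\beta$ satisfies $(r,\xi)$-clustering, where $\xi>0$ and $r\le\ell$: for all operators $A_X,B_Y$ supported on non-empty sets of sites $X,Y$ with $\mathrm{dist}(X,Y)=\min_{i\in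 X,j\in Y}\mathrm{dist}(i,j)\ge r$, $$|\langle A_XB_Y\rangle_\beta-\langle A_X\rangle_\beta\langle B_Y\rangle_\beta|\le\|A_X\|\,\|B_Y\|\,e^{-\mathrm{dist}(X,Y)/\xi}.$$ Let $(|E_m\rangle)_m$ be any orthonormal basis of eigenvectors of $H$, $H|E_m\rangle=E_m|E_m\rangle$. For $\Delta>0$ and $E\in\mathbb R$ let $\mathcal N_{E,\Delta}$ be the number of $m$ with $E_m\in(E-\Delta,E]$. Suppose that $E$ corresponds to $\beta$ in the sense that $E$ maximizes $E'\mapsto e^{-\beta E'}\mathcal N_{E',\Delta}$ over $E'\in\mathbb R$. Let $P_{E,\Delta}=\mathcal N_{E,\Delta}^{-1}\sum_{m:\,E_m\in(E-\Delta,E]}\delta_{\langle E_m|\Omega|E_m\rangle}$ be the distribution of the diagonal values over the eigenstates in the shell. Then for every $x_0>0$ $$P_{E,\Delta}\bigl(\{x:|x-\langle\Omega\rangle_\beta|\ge x_0\}\bigr)\le\min\Bigl[1,\;C_\Delta\max\Bigl(e^{-[x_0^2/(\tilde c_1n)]^{1/(d+1)}},\;e^{-x_0^2/(\tilde c_2\ell^dn)}\Bigr)\Bigr],$$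 where $\tilde c_1=16e\alpha(3\xi d/2)^d$, $\tilde c_2=3^d\cdot16e\alpha$, $C_\Delta=2e^{\beta\Delta}(e+3e\xi)\bigl[2+C_1\sqrt n/\Delta\bigr]$, and $C_1>0$ is a constant that depends only on $d$, $\alpha$, $\xi$ and (any upper bound on) $\max(\ell_0,r)$; in particular, as long as $r\le\ell_0$, only on $d,\alpha,\xi,\ell_0$. -/

import Mathlib

open scoped Matrix.Norms.L2Operator

namespace QSpin

/-- Operators on the Hilbert space of a system of spins with `q` levels, one on each site of `V`:
matrices in the product basis. The norm `‖A‖` is the operator norm on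
`EuclideanSpace ℂ (V → Fin q)`. -/
abbrev Op (V : Type*) (q : ℕ) := Matrix (V → Fin q) (V → Fin q) ℂ

/-- `A` acts non-trivially only on the spins in `X`, that is, `A = a ⊗ 1` for an operator `a` on the
spins in `X` and the identity `1` on the spins outside `X`. -/
def IsSupportedOn {V : Type*} {q : ℕ} (X : Set V) (A : Op V q) : Prop :=
  ∃ a : Matrix (X → Fin q) (X → Fin q) ℂ, ∀ σ τ : V → Fin q,
    ((∀ i, i ∉ X → σ i = τ i) → A σ τ = a (fun i => σ i) (fun i => τ i)) ∧
    (¬ (∀ i, i ∉ X → σ i = τ i) → A σ τ = 0)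

/-- The set of the sites at distance at most `s` from `i`. -/
def ball {V : Type*} (G : SimpleGraph V) (i : V) (s : ℕ) : Set V :=
  {j | G.dist i j ≤ s}

/-- The lattice has dimension `d` with geometric parameter `α`: every ball of radius `s ≥ 1` has at
most `α s ^ d` sites. -/
def HasGrowth {V : Type*} (G : SimpleGraph V) (d : ℕ) (α : ℝ) : Prop :=
  ∀ (i : V) (s : ℕ), 1 ≤ s → ((ball G i s).ncard : ℝ) ≤ α * (s : ℝ) ^ d

/-- `dist(X, Y)`, the least distance between a site of `X` and a site of `Y`. -/
noncomputable def setDist {V : Type*} (G : SimpleGraph V) (X Y : Set V) : ℕ :=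
  sInf {k | ∃ i ∈ X, ∃ j ∈ Y, G.dist i j = k}

section
variable {V : Type*} [Fintype V] [DecidableEq V] {q : ℕ}

/-- A family of local observables: the term at site `i` is self-adjoint, has operator norm at
most `1`, and acts on the spins at distance at most `s` from `i`. -/
structure IsLocalFamily (G : SimpleGraph V) (s : ℕ) (A : V → Op V q) : Prop where
  hermitian : ∀ i, (A i).IsHermitian
  norm_le : ∀ i, ‖A i‖ ≤ 1
  supported : ∀ i, IsSupportedOn (ball G i s) (A i)

/-- The partition function `Z_β = tr e^{-βH}`. -/
noncomputable def partitionFunction (H : Op V q) (β : ℝ) : ℂ :=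
  (NormedSpace.exp (-(β : ℂ) • H)).trace

/-- The canonical state `ρ_β = e^{-βH} / Z_β`. -/
noncomputable def gibbs (H : Op V q) (β : ℝ) : Op V q :=
  (partitionFunction H β)⁻¹ • NormedSpace.exp (-(β : ℂ) • H)

/-- The average `tr (ρ A)` of an observable `A` (a real number for self-adjoint `A` and `ρ`). -/
noncomputable def average (ρ A : Op V q) : ℝ :=
  (ρ * A).trace.re

/-- The `(r, ξ)`-clustering property of the density matrix `ρ`. -/
def IsClustering (G : SimpleGraph V) (ρ : Op V q) (r ξ : ℝ) : Prop :=
  ∀ (X Y : Set V) (A B : Op V q), X.Nonempty → Y.Nonempty →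
    IsSupportedOn X A → IsSupportedOn Y B → r ≤ (setDist G X Y : ℝ) →
    ‖(ρ * A * B).trace - (ρ * A).trace * (ρ * B).trace‖
      ≤ ‖A‖ * ‖B‖ * Real.exp (-(setDist G X Y : ℝ) / ξ)

/-- The expectation value `⟨φ|A|φ⟩` of an observable `A`. -/
noncomputable def expect (A : Op V q) (φ : EuclideanSpace ℂ (V → Fin q)) : ℝ :=
  (inner ℂ φ (Matrix.toEuclideanLin A φ)).re

end

/-- The labels `m` of the eigenstates with energy in the shell `(E - Δ, E]`. -/
noncomputable def shell {N : ℕ} (En : Fin N → ℝ) (E Δ : ℝ) : Finset (Fin N) :=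
  {m | En m ∈ Set.Ioc (E - Δ) E}

/-- The distribution of the values `x m` over the eigenstates `m` in the energy shell, each
eigenstate in the shell having the same weight. -/
noncomputable def shellDistribution {N : ℕ} (En x : Fin N → ℝ) (E Δ : ℝ) :
    MeasureTheory.Measure ℝ :=
  ((shell En E Δ).card : ENNReal)⁻¹ • ∑ m ∈ shell En E Δ, MeasureTheory.Measure.dirac (x m)

/-- `c̃₁ = 16 e α (3 ξ d / 2) ^ d`. -/
noncomputable def c1 (d : ℕ) (α ξ : ℝ) : ℝ :=
  16 * Real.exp 1 * α * (3 * ξ * d / 2) ^ d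

/-- `c̃₂ = 3 ^ d (16 e α)`. -/
noncomputable def c2 (d : ℕ) (α : ℝ) : ℝ :=
  3 ^ d * (16 * Real.exp 1 * α)

/-- `C_Δ = 2 e^{βΔ} (e + 3 e ξ) (2 + C₁ √n / Δ)`. -/
noncomputable def CDelta (C₁ β Δ ξ : ℝ) (n : ℕ) : ℝ :=
  2 * Real.exp (β * Δ) * (Real.exp 1 + 3 * Real.exp 1 * ξ) * (2 + C₁ * Real.sqrt n / Δ)

end QSpin

/-! Everything rests on an even moment bound in the Gibbs state, `norm_trace_mul_sum_pow_le`. Expand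
the power `2 * m` of the centred observable over tuples of `2 * m` sites. If one site of a tuple
lies farther than `t ≥ 3 * ℓ` from all the others, its factor commutes past those to its right, and
clustering bounds the term by `4 ^ m * exp (-(t + 1) / (3 * ξ))`. Tuples with no site isolated at
scale `t` number at most `(4 * n * m * α * t ^ d) ^ m`, since a relation without isolated points has
a dominating set of at most half the points (`card_no_isolated_le`). Summation by parts in `t`,
compared with a Gamma integral, gives `3 * momentScale ^ m`.

By Jensen's inequality for spectral measures, the diagonal values have moments no larger than the
operator moments. Passing from the Gibbs weights to the shell uses that every state in the shell has
weight at least `exp (-β * E)`, so Markov's inequality loses only the ratio of `Z` to `exp (-β * E)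
* 𝒩` (`shellDistribution_real_le`). This ratio is controlled by the moment bound with `m = 1`
applied to `H`: three quarters of the weight sits in an energy window of width of order `√n`, and
each shell needed to cover it weighs at most `exp (β * Δ)` times the maximal value
(`boltzmannSum_le`).

Finally `m` is the integer part of the smaller of the two exponents in the claim; the moment ratio
is then at most `exp (-m)`, and rounding costs a factor `e`. -/

namespace QSpin

/-! ### Algebra of operators with given support. -/

section Support

open scoped Kronecker

variable {V : Type*} [Fintype V] {q : ℕ} {X Y : Set V} {A B : Op V q}

open Classical in
/-- Configurations of all spins are pairs of a configuration in `X` and one outside `X`. -/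
noncomputable def splitEquiv (X : Set V) (q : ℕ) :
    (V → Fin q) ≃ (({i // i ∈ X} → Fin q) × ({i // ¬ i ∈ X} → Fin q)) :=
  Equiv.piEquivPiSubtypeProd (fun i => i ∈ X) (fun _ => Fin q)

-- Brings the entrywise definition into the form `a ⊗ 1`, so that products and commutators follow
-- from the mixed-product rule.
open Classical in
theorem isSupportedOn_iff_kronecker :
    IsSupportedOn X A ↔ ∃ a : Matrix ({i // i ∈ X} → Fin q) ({i // i ∈ X} → Fin q) ℂ,
      A = (a ⊗ₖ (1 : Matrix ({i // ¬ i ∈ X} → Fin q) ({i // ¬ i ∈ X} → Fin q) ℂ)).submatrix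
        (splitEquiv X q) (splitEquiv X q) := by
  refine exists_congr fun a => ⟨fun h => ?_, fun h σ τ => ?_⟩
  · ext σ τ
    by_cases hst : ∀ i, i ∉ X → σ i = τ i
    · have : (fun i : {i // ¬ i ∈ X} => σ i) = (fun i : {i // ¬ i ∈ X} => τ i) := funext fun i => hst i i.2
      rw [(h σ τ).1 hst]
      simp [splitEquiv, this]
    · have : ¬ (fun i : {i // ¬ i ∈ X} => σ i) = (fun i : {i // ¬ i ∈ X} => τ i) := fun h' =>
        hst fun i hi => congrFun h' ⟨i, hi⟩
      rw [(h σ τ).2 hst]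
      simp [splitEquiv, this]
  · subst h
    refine ⟨fun hst => ?_, fun hst => ?_⟩
    · have : (fun i : {i // ¬ i ∈ X} => σ i) = (fun i : {i // ¬ i ∈ X} => τ i) := funext fun i => hst i i.2
      simp [splitEquiv, this]
    · have : ¬ (fun i : {i // ¬ i ∈ X} => σ i) = (fun i : {i // ¬ i ∈ X} => τ i) := fun h' =>
        hst fun i hi => congrFun h' ⟨i, hi⟩
      simp [splitEquiv, this]

open Classical in
theorem exists_kronecker_of_isSupportedOn_compl (hA : IsSupportedOn Xᶜ A) :
    ∃ a : Matrix ({i // ¬ i ∈ X} → Fin q) ({i // ¬ i ∈ X} → Fin q) ℂ,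
      A = ((1 : Matrix ({i // i ∈ X} → Fin q) ({i // i ∈ X} → Fin q) ℂ) ⊗ₖ a).submatrix
        (splitEquiv X q) (splitEquiv X q) := by
  obtain ⟨a, ha⟩ := hA
  refine ⟨a, ?_⟩
  ext σ τ
  by_cases hst : ∀ i, i ∉ Xᶜ → σ i = τ i
  · have : (fun i : {i // i ∈ X} => σ i) = (fun i : {i // i ∈ X} => τ i) :=
      funext fun i => hst i (by simp)
    rw [(ha σ τ).1 hst]
    simp [splitEquiv, this]
    rfl
  · have : ¬ (fun i : {i // i ∈ X} => σ i) = (fun i : {i // i ∈ X} => τ i) := fun h' =>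
      hst fun i hi => congrFun h' ⟨i, by simpa using hi⟩
    rw [(ha σ τ).2 hst]
    simp [splitEquiv, this]

theorem IsSupportedOn.sub_smul_one (hA : IsSupportedOn X A) (c : ℂ) :
    IsSupportedOn X (A - c • (1 : Op V q)) := by
  classical
  obtain ⟨a, rfl⟩ := isSupportedOn_iff_kronecker.1 hA
  refine isSupportedOn_iff_kronecker.2 ⟨a - c • 1, ?_⟩
  have h : ((a - c • 1) ⊗ₖ 1 : Matrix (({i // i ∈ X} → Fin q) × ({i // ¬ i ∈ X} → Fin q))
      (({i // i ∈ X} → Fin q) × ({i // ¬ i ∈ X} → Fin q)) ℂ)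
      = a ⊗ₖ 1 - c • ((1 : Matrix _ _ ℂ) ⊗ₖ (1 : Matrix _ _ ℂ)) := by
    ext
    simp only [Matrix.kroneckerMap_apply, Matrix.sub_apply, Matrix.smul_apply, smul_eq_mul]
    ring
  rw [h, Matrix.one_kronecker_one, Matrix.submatrix_sub, Matrix.submatrix_smul]
  simp

theorem isSupportedOn_one : IsSupportedOn X (1 : Op V q) := by
  classical
  exact isSupportedOn_iff_kronecker.2 ⟨1, by simp⟩

variable [DecidableEq V]

theorem IsSupportedOn.mul (hA : IsSupportedOn X A) (hB : IsSupportedOn X B) :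
    IsSupportedOn X (A * B) := by
  classical
  obtain ⟨a, rfl⟩ := isSupportedOn_iff_kronecker.1 hA
  obtain ⟨b, rfl⟩ := isSupportedOn_iff_kronecker.1 hB
  refine isSupportedOn_iff_kronecker.2 ⟨a * b, ?_⟩
  rw [Matrix.submatrix_mul_equiv, ← Matrix.mul_kronecker_mul, one_mul]

theorem IsSupportedOn.commute (hA : IsSupportedOn X A) (hB : IsSupportedOn Xᶜ B) :
    Commute A B := by
  classical
  obtain ⟨a, rfl⟩ := isSupportedOn_iff_kronecker.1 hA
  obtain ⟨b, rfl⟩ := exists_kronecker_of_isSupportedOn_compl hB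
  simp only [Commute, SemiconjBy, Matrix.submatrix_mul_equiv, ← Matrix.mul_kronecker_mul, one_mul,
    mul_one]

omit [Fintype V] [DecidableEq V] in
theorem IsSupportedOn.mono [NeZero q] (hA : IsSupportedOn X A) (hXY : X ⊆ Y) :
    IsSupportedOn Y A := by
  classical
  obtain ⟨a, ha⟩ := hA
  -- The filling level `0` is arbitrary: entries of `A` do not depend on spins outside `X` where
  -- both configurations agree.
  let ext (s : Y → Fin q) : V → Fin q := fun i => if h : i ∈ Y then s ⟨i, h⟩ else 0
  refine ⟨fun s t => A (ext s) (ext t), fun σ τ => ⟨fun h => ?_, fun h => ?_⟩⟩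
  · have hσ : ∀ (σ : V → Fin q) i, i ∈ Y → ext (fun i => σ i) i = σ i := fun σ i hi => by
      simp [ext, hi]
    by_cases hX : ∀ i, i ∉ X → σ i = τ i
    · change _ = A (ext fun i => σ i) (ext fun i => τ i)
      rw [(ha σ τ).1 hX, (ha _ _).1]
      · congr 1 <;> funext i <;> rw [hσ _ _ (hXY i.2)]
      · intro i hi
        by_cases hiY : i ∈ Y
        · rw [hσ _ _ hiY, hσ _ _ hiY, hX i hi]
        · simp [ext, hiY]
    · change _ = A (ext fun i => σ i) (ext fun i => τ i)
      rw [(ha σ τ).2 hX, (ha _ _).2]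
      intro h'
      refine hX fun i hi => ?_
      by_cases hiY : i ∈ Y
      · rw [← hσ σ _ hiY, ← hσ τ _ hiY, h' i hi]
      · exact h i hiY
  · exact (ha σ τ).2 fun h' => h fun i hi => h' i fun hiX => hi (hXY hiX)

theorem IsSupportedOn.list_prod {L : List (Op V q)} (hL : ∀ A ∈ L, IsSupportedOn X A) :
    IsSupportedOn X L.prod := by
  induction L with
  | nil => exact isSupportedOn_one
  | cons A L ih =>
    rw [List.prod_cons]
    exact (hL A (by simp)).mul (ih fun B hB => hL B (by simp [hB]))

end Support

/-! ### Counting tuples without isolated points. -/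

section Counting

/-- A relation without isolated points on a finite type with at most `2 * m` points has a dominating set of at
most `m` points. -/
theorem exists_dominating_card_le {κ : Type*} [Fintype κ] [DecidableEq κ] {m : ℕ}
    (hκ : Fintype.card κ ≤ 2 * m) {r : κ → κ → Prop} (hr : ∀ k l, r k l → r l k)
    (hiso : ∀ k, ∃ l, l ≠ k ∧ r k l) :
    ∃ J : Finset κ, J.card ≤ m ∧ ∀ k, k ∉ J → ∃ l ∈ J, r k l := by
  classical
  -- Either a minimal dominating set is small or its complement is. The complement dominates too: a
  -- point of `J` related to nothing outside `J` has its partner in `J`, so it could be removed.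
  obtain ⟨J, hJ, hmin⟩ := Finset.exists_minimal (s := {J : Finset κ | ∀ k, k ∉ J → ∃ l ∈ J, r k l})
    ⟨Finset.univ, by simp⟩
  simp only [Finset.mem_filter, Finset.mem_univ, true_and] at hJ hmin
  by_cases hcard : J.card ≤ m
  · exact ⟨J, hcard, hJ⟩
  refine ⟨Jᶜ, by rw [Finset.card_compl]; omega, fun v hv => ?_⟩
  by_contra! hno
  have hvJ : v ∈ J := by simpa using hv
  obtain ⟨u, huv, hvu⟩ := hiso v
  have huJ : u ∈ J := by
    by_contra h
    exact hno u (by simpa using h) hvu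
  have := @hmin (J.erase v) (fun k hk => ?_) (Finset.erase_subset v J) v hvJ
  · simp at this
  · by_cases hkv : k = v
    · subst hkv
      exact ⟨u, Finset.mem_erase.2 ⟨huv, huJ⟩, hvu⟩
    · have hkJ : k ∉ J := fun h => hk (Finset.mem_erase.2 ⟨hkv, h⟩)
      obtain ⟨l, hl, hkl⟩ := hJ k hkJ
      refine ⟨l, Finset.mem_erase.2 ⟨?_, hl⟩, hkl⟩
      rintro rfl
      exact hno k (by simpa using hkJ) (hr _ _ hkl)

-- The values on `J` are free; each other value lies in the union of `J.card` neighbourhoods of size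
-- at most `b`.
open Classical in
theorem card_dominated_le {V κ : Type*} [Fintype V] [Fintype κ] [DecidableEq κ]
    (r : V → V → Prop) {b : ℝ} (hb : ∀ i, (({j | r i j} : Finset V).card : ℝ) ≤ b)
    (J : Finset κ) :
    (({f : κ → V | ∀ k, k ∉ J → ∃ l ∈ J, r (f l) (f k)} : Finset (κ → V)).card : ℝ)
      ≤ (Fintype.card V : ℝ) ^ J.card * (J.card * b) ^ (Fintype.card κ - J.card) := by
  let U (h : {k // k ∈ J} → V) : Finset V := Finset.univ.biUnion fun l => {j | r (h l) j}
  have hU : ∀ h, ((U h).card : ℝ) ≤ J.card * b := fun h => by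
    calc ((U h).card : ℝ) ≤ ∑ l, (({j | r (h l) j} : Finset V).card : ℝ) := by
          exact_mod_cast Finset.card_biUnion_le
      _ ≤ ∑ l : {k // k ∈ J}, b := Finset.sum_le_sum fun l _ => hb _
      _ = J.card * b := by simp
  let S : Finset (({k // k ∈ J} → V) × ({k // ¬ k ∈ J} → V)) :=
    {p | ∀ k, p.2 k ∈ U p.1}
  have h1 : ({f : κ → V | ∀ k, k ∉ J → ∃ l ∈ J, r (f l) (f k)} : Finset (κ → V)).card ≤ S.card := by
    refine Finset.card_le_card_of_injOn (Equiv.piEquivPiSubtypeProd (fun k => k ∈ J) fun _ => V)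
      (fun f hf => ?_) (Equiv.injective _).injOn
    simp only [Finset.coe_filter, Finset.mem_univ, true_and, Set.mem_ofPred_eq] at hf
    simp only [S, U, Finset.coe_filter, Finset.mem_univ, true_and, Set.mem_ofPred_eq,
      Finset.mem_biUnion, Finset.mem_filter]
    rintro ⟨k, hk⟩
    obtain ⟨l, hl, hr⟩ := hf k hk
    exact ⟨⟨l, hl⟩, hr⟩
  have h2 : S.card = ∑ h : {k // k ∈ J} → V, (U h).card ^ (Fintype.card κ - J.card) := by
    have : ∀ h : {k // k ∈ J} → V, (U h).card ^ (Fintype.card κ - J.card)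
        = (Fintype.piFinset fun _ : {k // ¬ k ∈ J} => U h).card := fun h => by
      rw [Fintype.card_piFinset, Finset.prod_const, Finset.card_univ, Fintype.card_subtype_compl]
      simp
    simp only [this]
    rw [← Finset.card_sigma]
    refine Finset.card_bij' (fun p _ => ⟨p.1, p.2⟩) (fun p _ => (p.1, p.2)) ?_ ?_ ?_ ?_ <;>
      simp [S]
  calc _ ≤ (S.card : ℝ) := by exact_mod_cast h1
    _ = ∑ h : {k // k ∈ J} → V, ((U h).card : ℝ) ^ (Fintype.card κ - J.card) := by
      rw [h2]; push_cast; rfl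
    _ ≤ ∑ h : {k // k ∈ J} → V, (J.card * b) ^ (Fintype.card κ - J.card) :=
      Finset.sum_le_sum fun h _ => pow_le_pow_left₀ (by positivity) (hU h) _
    _ = _ := by simp

open Classical in
/-- The number of tuples of `2 * m` points in which every point has another one nearby. -/
theorem card_no_isolated_le {V : Type*} [Fintype V] (r : V → V → Prop)
    (hr : ∀ i j, r i j → r j i) {b : ℝ} (hb0 : 0 ≤ b)
    (hb : ∀ i, (({j | r i j} : Finset V).card : ℝ) ≤ b) (m : ℕ) :
    (({f : Fin (2 * m) → V | ∀ k, ∃ l, l ≠ k ∧ r (f k) (f l)} : Finset (Fin (2 * m) → V)).card : ℝ)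
      ≤ (4 * (Fintype.card V * (m * b))) ^ m := by
  set n : ℝ := (Fintype.card V : ℝ) with hn
  have hn0 : 0 ≤ n := by positivity
  have hmb : 0 ≤ m * b := by positivity
  -- If `n ≤ m * b`, counting all `n ^ (2 * m)` tuples is enough.
  rcases le_total n (m * b) with hle | hle
  · calc _ ≤ ((Finset.univ : Finset (Fin (2 * m) → V)).card : ℝ) := by
          exact_mod_cast Finset.card_le_card (Finset.filter_subset _ _)
      _ = (n * n) ^ m := by
        simp [hn, pow_mul, sq]
      _ ≤ _ := by
        exact pow_le_pow_left₀ (by positivity)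
          (by nlinarith [mul_le_mul_of_nonneg_left hle hn0, mul_nonneg hn0 hmb]) _
  · have hsub : ({f : Fin (2 * m) → V | ∀ k, ∃ l, l ≠ k ∧ r (f k) (f l)} : Finset _) ⊆
        ({J : Finset (Fin (2 * m)) | J.card ≤ m} : Finset _).biUnion fun J =>
          {f : Fin (2 * m) → V | ∀ k, k ∉ J → ∃ l ∈ J, r (f l) (f k)} := fun f hf => by
      simp only [Finset.mem_filter, Finset.mem_univ, true_and, Finset.mem_biUnion] at hf ⊢
      obtain ⟨J, hJ, hd⟩ := exists_dominating_card_le (m := m) (by simp)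
        (r := fun k l => r (f k) (f l)) (fun k l => hr _ _) hf
      exact ⟨J, hJ, fun k hk => (hd k hk).imp fun l h => ⟨h.1, hr _ _ h.2⟩⟩
    calc _ ≤ ∑ J : Finset (Fin (2 * m)) with J.card ≤ m,
          (({f : Fin (2 * m) → V | ∀ k, k ∉ J → ∃ l ∈ J, r (f l) (f k)} : Finset _).card : ℝ) := by
          exact_mod_cast (Finset.card_le_card hsub).trans Finset.card_biUnion_le
      _ ≤ ∑ J : Finset (Fin (2 * m)) with J.card ≤ m, (n * (m * b)) ^ m := by
        refine Finset.sum_le_sum fun J hJ => ?_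
        have hJm : J.card ≤ m := by simpa using hJ
        refine (le_of_eq ?_).trans ((card_dominated_le r hb J).trans ?_)
        · congr!
        -- Of the factors `J.card * b`, `m - J.card` are replaced by `n`, which completes `n ^
        -- J.card` to `n ^ m` whatever the size of `J`.
        have e : Fintype.card (Fin (2 * m)) - J.card = (m - J.card) + m := by simp; omega
        rw [e, pow_add]
        calc n ^ J.card * ((J.card * b) ^ (m - J.card) * (J.card * b) ^ m)
            ≤ n ^ J.card * (n ^ (m - J.card) * (m * b) ^ m) := by
              have h : (J.card : ℝ) * b ≤ m * b := by gcongr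
              gcongr
              exact h.trans hle
          _ = (n * (m * b)) ^ m := by
            rw [← mul_assoc, ← pow_add, Nat.add_sub_cancel' hJm, ← mul_pow]
      _ = (({J : Finset (Fin (2 * m)) | J.card ≤ m} : Finset _).card : ℝ) * (n * (m * b)) ^ m := by
        simp
      _ ≤ 4 ^ m * (n * (m * b)) ^ m := by
        gcongr
        have : ({J : Finset (Fin (2 * m)) | J.card ≤ m} : Finset _).card ≤ 4 ^ m := by
          refine (Finset.card_le_univ _).trans ?_
          simp [pow_mul]
        exact_mod_cast this
      _ = _ := by rw [mul_pow 4]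

end Counting

/-! ### Eigenvectors, traces and expectation values. -/

section Spectral

variable {I κ : Type*} [Fintype I] [DecidableEq I] [Fintype κ]

theorem toEuclideanLin_pow_apply_of_eigen {A : Matrix I I ℂ} {v : EuclideanSpace ℂ I} {c : ℂ}
    (h : Matrix.toEuclideanLin A v = c • v) (k : ℕ) :
    Matrix.toEuclideanLin (A ^ k) v = c ^ k • v := by
  change Matrix.toEuclideanCLM (𝕜 := ℂ) A v = c • v at h
  change Matrix.toEuclideanCLM (𝕜 := ℂ) (A ^ k) v = c ^ k • v
  rw [map_pow]
  induction k with
  | zero => simp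
  | succ k ih =>
    rw [pow_succ, mul_apply_eq_comp, h, map_smul, ih, smul_smul, pow_succ, mul_comm]

theorem toEuclideanLin_exp_apply_of_eigen {A : Matrix I I ℂ} {v : EuclideanSpace ℂ I} {c : ℂ}
    (h : Matrix.toEuclideanLin A v = c • v) :
    Matrix.toEuclideanLin (NormedSpace.exp A) v = NormedSpace.exp c • v := by
  have h1 := NormedSpace.exp_series_hasSum_exp' (𝕂 := ℂ) A
  have h2 := NormedSpace.exp_series_hasSum_exp' (𝕂 := ℂ) c
  let T : Matrix I I ℂ →ₗ[ℂ] EuclideanSpace ℂ I :=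
    (LinearMap.applyₗ v).comp (Matrix.toEuclideanLin (𝕜 := ℂ)).toLinearMap
  have h3 := h1.map T.toContinuousLinearMap T.toContinuousLinearMap.continuous
  refine h3.unique ?_
  convert h2.smul_const v using 1
  funext k
  simp only [Function.comp_apply, map_smul]
  change _ • Matrix.toEuclideanLin (A ^ k) v = _
  rw [toEuclideanLin_pow_apply_of_eigen h, smul_smul]
  rfl

theorem trace_eq_sum_inner (A : Matrix I I ℂ) (ψ : OrthonormalBasis κ ℂ (EuclideanSpace ℂ I)) :
    A.trace = ∑ m, inner ℂ (ψ m) (Matrix.toEuclideanLin A (ψ m)) := by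
  rw [← LinearMap.trace_eq_sum_inner, Matrix.toEuclideanLin_eq_toLin_orthonormal,
    Matrix.trace_toLin_eq]

theorem norm_inner_le (A : Matrix I I ℂ) {v : EuclideanSpace ℂ I} (hv : ‖v‖ = 1) :
    ‖inner ℂ v (Matrix.toEuclideanLin A v)‖ ≤ ‖A‖ := by
  refine (norm_inner_le_norm _ _).trans ?_
  have := (Matrix.toEuclideanCLM (𝕜 := ℂ) A).le_opNorm v
  rw [hv, mul_one] at this
  rw [hv, one_mul]
  exact this

theorem inner_im_eq_zero {A : Matrix I I ℂ} (hA : A.IsHermitian) (v : EuclideanSpace ℂ I) :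
    (inner ℂ v (Matrix.toEuclideanLin A v)).im = 0 := by
  have h := Matrix.isSymmetric_toEuclideanLin_iff.2 hA
  have := h.im_inner_self_apply v
  exact this

/-- The power mean inequality for the expectation values of a self-adjoint operator. -/
theorem re_inner_pow_le {A : Matrix I I ℂ} (hA : A.IsHermitian) {v : EuclideanSpace ℂ I}
    (hv : ‖v‖ = 1) (k : ℕ) :
    (inner ℂ v (Matrix.toEuclideanLin A v)).re ^ (2 * k)
      ≤ (inner ℂ v (Matrix.toEuclideanLin (A ^ (2 * k)) v)).re := by
  -- The squared overlaps with an eigenbasis of `A` form a probability distribution whose moments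
  -- are the expectations of `A ^ j`.
  have key : ∀ j, (inner ℂ v (Matrix.toEuclideanLin (A ^ j) v)).re
      = ∑ i, ‖inner ℂ (hA.eigenvectorBasis i) v‖ ^ 2 * hA.eigenvalues i ^ j := fun j => by
    conv_lhs =>
      enter [1, 3, 2]
      rw [← hA.eigenvectorBasis.sum_repr' v]
    rw [map_sum, inner_sum, Complex.re_sum]
    refine Finset.sum_congr rfl fun i _ => ?_
    have h : Matrix.toEuclideanLin A (hA.eigenvectorBasis i)
        = (hA.eigenvalues i : ℂ) • hA.eigenvectorBasis i := by
      apply PiLp.ext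
      intro x
      have := congrFun (hA.mulVec_eigenvectorBasis i) x
      simpa [Matrix.toLpLin_apply] using this
    rw [map_smul, toEuclideanLin_pow_apply_of_eigen h, inner_smul_right, inner_smul_right,
      ← inner_conj_symm v, mul_left_comm, Complex.mul_conj, Complex.normSq_eq_norm_sq]
    norm_cast
    rw [mul_comm]
  have h1 := key 1
  simp only [pow_one] at h1
  rw [h1, key]
  refine Real.pow_arith_mean_le_arith_mean_pow_of_even _ _ _ (fun i _ => by positivity) ?_
    (even_two_mul k)
  rw [hA.eigenvectorBasis.sum_sq_norm_inner_right, hv, one_pow]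

end Spectral

/-! ### Gibbs averages as Boltzmann sums. -/

section Gibbs

variable {V κ : Type*} [Fintype V] [DecidableEq V] {q : ℕ} [Fintype κ] [Nonempty κ]
  {H : Op V q} {ψ : OrthonormalBasis κ ℂ (EuclideanSpace ℂ (V → Fin q))} {En : κ → ℝ}

/-- The sum of the Boltzmann weights of the energies `En`. -/
noncomputable def boltzmannSum (En : κ → ℝ) (β : ℝ) : ℝ := ∑ m, Real.exp (-β * En m)

theorem boltzmannSum_pos (β : ℝ) : 0 < boltzmannSum En β :=
  Finset.sum_pos (fun _ _ => Real.exp_pos _) Finset.univ_nonempty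

omit [Nonempty κ] in
theorem trace_exp_mul (hψ : ∀ m, Matrix.toEuclideanLin H (ψ m) = (En m : ℂ) • ψ m) (β : ℝ)
    (A : Op V q) :
    (NormedSpace.exp (-(β : ℂ) • H) * A).trace
      = ∑ m, (Real.exp (-β * En m) : ℂ) * inner ℂ (ψ m) (Matrix.toEuclideanLin A (ψ m)) := by
  rw [Matrix.trace_mul_comm, trace_eq_sum_inner _ ψ]
  refine Finset.sum_congr rfl fun m _ => ?_
  have h : Matrix.toEuclideanLin (-(β : ℂ) • H) (ψ m) = (-(β : ℂ) * En m) • ψ m := by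
    rw [map_smul, LinearMap.smul_apply, hψ, smul_smul]
  have h2 := toEuclideanLin_exp_apply_of_eigen h
  change Matrix.toEuclideanCLM (𝕜 := ℂ) _ (ψ m) = _ at h2
  change inner ℂ (ψ m) (Matrix.toEuclideanCLM (𝕜 := ℂ) _ (ψ m)) = _
  rw [map_mul, mul_apply_eq_comp, h2, map_smul, inner_smul_right,
    ← Complex.exp_eq_exp_ℂ]
  push_cast
  rfl

omit [Nonempty κ] in
theorem partitionFunction_eq (hψ : ∀ m, Matrix.toEuclideanLin H (ψ m) = (En m : ℂ) • ψ m) (β : ℝ) :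
    partitionFunction H β = boltzmannSum En β := by
  have h := trace_exp_mul hψ β 1
  rw [mul_one] at h
  rw [partitionFunction, h, boltzmannSum]
  push_cast
  refine Finset.sum_congr rfl fun m _ => ?_
  have : Matrix.toEuclideanLin (1 : Op V q) (ψ m) = ψ m := by
    change Matrix.toEuclideanCLM (𝕜 := ℂ) (1 : Op V q) (ψ m) = ψ m
    simp
  rw [this, inner_self_eq_norm_sq_to_K, ψ.norm_eq_one]
  simp

omit [Nonempty κ] in
theorem trace_gibbs_mul (hψ : ∀ m, Matrix.toEuclideanLin H (ψ m) = (En m : ℂ) • ψ m) (β : ℝ)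
    (A : Op V q) :
    (gibbs H β * A).trace = (boltzmannSum En β : ℂ)⁻¹ *
      ∑ m, (Real.exp (-β * En m) : ℂ) * inner ℂ (ψ m) (Matrix.toEuclideanLin A (ψ m)) := by
  rw [gibbs, partitionFunction_eq hψ, Matrix.smul_mul, Matrix.trace_smul, trace_exp_mul hψ,
    smul_eq_mul]

theorem trace_gibbs (hψ : ∀ m, Matrix.toEuclideanLin H (ψ m) = (En m : ℂ) • ψ m) (β : ℝ) :
    (gibbs H β).trace = 1 := by
  rw [gibbs, Matrix.trace_smul, smul_eq_mul, ← partitionFunction, partitionFunction_eq hψ,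
    inv_mul_cancel₀]
  exact_mod_cast (boltzmannSum_pos β).ne'

theorem norm_trace_gibbs_mul_le (hψ : ∀ m, Matrix.toEuclideanLin H (ψ m) = (En m : ℂ) • ψ m)
    (β : ℝ) (A : Op V q) : ‖(gibbs H β * A).trace‖ ≤ ‖A‖ := by
  have hZ := boltzmannSum_pos (En := En) β
  rw [trace_gibbs_mul hψ, norm_mul, norm_inv, Complex.norm_real, Real.norm_of_nonneg hZ.le,
    inv_mul_le_iff₀ hZ, boltzmannSum, Finset.sum_mul]
  refine norm_sum_le_of_le _ fun m _ => ?_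
  rw [norm_mul, Complex.norm_real, Real.norm_of_nonneg (Real.exp_pos _).le]
  exact mul_le_mul_of_nonneg_left (norm_inner_le A (ψ.norm_eq_one m)) (Real.exp_pos _).le

omit [Nonempty κ] in
theorem average_gibbs (hψ : ∀ m, Matrix.toEuclideanLin H (ψ m) = (En m : ℂ) • ψ m) (β : ℝ)
    (A : Op V q) :
    average (gibbs H β) A = (boltzmannSum En β)⁻¹ * ∑ m, Real.exp (-β * En m) * expect A (ψ m) := by
  rw [average, trace_gibbs_mul hψ, ← Complex.ofReal_inv, Complex.re_ofReal_mul, Complex.re_sum]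
  simp only [Complex.re_ofReal_mul, expect]

omit [Nonempty κ] in
theorem trace_gibbs_mul_hermitian
    (hψ : ∀ m, Matrix.toEuclideanLin H (ψ m) = (En m : ℂ) • ψ m) (β : ℝ)
    {A : Op V q} (hA : A.IsHermitian) : (gibbs H β * A).trace = average (gibbs H β) A := by
  apply Complex.ext
  · simp [average]
  · rw [trace_gibbs_mul hψ, ← Complex.ofReal_inv, Complex.im_ofReal_mul, Complex.im_sum]
    simp only [Complex.im_ofReal_mul, inner_im_eq_zero hA]
    simp

theorem expect_sub_smul_one (A : Op V q) (c : ℝ) {v : EuclideanSpace ℂ (V → Fin q)}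
    (hv : ‖v‖ = 1) : expect (A - (c : ℂ) • (1 : Op V q)) v = expect A v - c := by
  have : Matrix.toEuclideanLin (1 : Op V q) v = v := by
    change Matrix.toEuclideanCLM (𝕜 := ℂ) (1 : Op V q) v = v
    simp
  rw [expect, expect, map_sub, map_smul, LinearMap.sub_apply, LinearMap.smul_apply, this,
    inner_sub_right, inner_smul_right, inner_self_eq_norm_sq_to_K, hv]
  simp

omit [Nonempty κ] in
/-- The moments of the diagonal values are bounded by the quantum mechanical ones. -/
theorem sum_exp_mul_expect_sub_pow_le
    (hψ : ∀ m, Matrix.toEuclideanLin H (ψ m) = (En m : ℂ) • ψ m) (β : ℝ)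
    {A : Op V q} (hA : A.IsHermitian) (c : ℝ) (k : ℕ) :
    (boltzmannSum En β)⁻¹ * ∑ m, Real.exp (-β * En m) * (expect A (ψ m) - c) ^ (2 * k)
      ≤ average (gibbs H β) ((A - (c : ℂ) • (1 : Op V q)) ^ (2 * k)) := by
  rw [average_gibbs hψ]
  have hB : (A - (c : ℂ) • (1 : Op V q)).IsHermitian := by
    refine hA.sub ?_
    rw [Matrix.IsHermitian, Matrix.conjTranspose_smul, Matrix.conjTranspose_one]
    simp
  refine mul_le_mul_of_nonneg_left (Finset.sum_le_sum fun m _ =>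
    mul_le_mul_of_nonneg_left ?_ (Real.exp_pos _).le)
    (inv_nonneg.2 (Finset.sum_nonneg fun _ _ => (Real.exp_pos _).le))
  rw [← expect_sub_smul_one A c (ψ.norm_eq_one m)]
  exact re_inner_pow_le hB (ψ.norm_eq_one m) k

end Gibbs

/-! ### Factorials, summation by parts and expansion of powers. -/

section Tail

/-- Used with `k = d * m`, it turns the Gamma integral into an `m`-th power and produces the `d / 2`
in `c1`. -/
theorem factorial_le_two_mul_half_pow (k : ℕ) : (k.factorial : ℝ) ≤ 2 * ((k : ℝ) / 2) ^ k := by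
  induction k with
  | zero => simp
  | succ k ih =>
    rcases Nat.eq_zero_or_pos k with rfl | hk
    · norm_num
    have hk' : (0 : ℝ) < k := by exact_mod_cast hk
    -- Bernoulli's inequality in the form `(1 + 1 / k) ^ k ≥ 2`.
    have h1 : 2 * (k : ℝ) ^ k ≤ ((k : ℝ) + 1) ^ k := by
      have := one_add_mul_le_pow (a := 1 / (k : ℝ)) (by have : 0 < 1 / (k : ℝ) := by positivity
                                                        linarith) k
      rw [mul_one_div_cancel hk'.ne'] at this
      have e : ((k : ℝ) + 1) = k * (1 + 1 / k) := by field_simp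
      rw [e, mul_pow]
      nlinarith [pow_pos hk' k]
    rw [Nat.factorial_succ]
    push_cast
    calc ((k : ℝ) + 1) * k.factorial ≤ (k + 1) * (2 * ((k : ℝ) / 2) ^ k) := by gcongr
      _ = (k + 1) / 2 ^ k * (2 * (k : ℝ) ^ k) := by rw [div_pow]; ring
      _ ≤ (k + 1) / 2 ^ k * ((k : ℝ) + 1) ^ k := by gcongr
      _ = _ := by rw [div_pow]; field_simp; ring

/-- A lower sum for the moments of an exponential distribution of mean `a`. -/
theorem sum_pow_sub_pow_mul_exp_le {a : ℝ} (ha : 0 < a) (k : ℕ) (hk : 1 ≤ k) {s S : ℕ}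
    (hsS : s ≤ S) :
    ∑ t ∈ Finset.Ico s S, (((t + 1 : ℕ) : ℝ) ^ k - (t : ℝ) ^ k) * Real.exp (-((t + 1 : ℕ) : ℝ) / a)
      ≤ k.factorial * a ^ k := by
  obtain ⟨j, rfl⟩ : ∃ j, k = j + 1 := ⟨k - 1, by omega⟩
  let g : ℝ → ℝ := fun x => (j + 1) * x ^ j * Real.exp (-x / a)
  have hg : Continuous g := by fun_prop
  have hint : MeasureTheory.IntegrableOn g (Set.Ioi 0) ∧
      ∫ x in Set.Ioi 0, g x = (j + 1).factorial * a ^ (j + 1) := by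
    have h1 := Real.integral_rpow_mul_exp_neg_mul_Ioi (a := (j : ℝ) + 1) (r := 1 / a)
      (by positivity) (by positivity)
    have hcongr : ∀ x ∈ Set.Ioi (0 : ℝ),
        (j + 1 : ℝ) * (x ^ ((j : ℝ) + 1 - 1) * Real.exp (-(1 / a * x))) = g x := fun x _ => by
      simp only [g, add_sub_cancel_right, Real.rpow_natCast, mul_assoc]
      congr 3
      ring
    have h2 : ∫ x in Set.Ioi 0, g x = (j + 1).factorial * a ^ (j + 1) := by
      rw [← MeasureTheory.setIntegral_congr_fun measurableSet_Ioi hcongr,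
        MeasureTheory.integral_const_mul, h1, Real.Gamma_nat_eq_factorial, Nat.factorial_succ]
      have : (1 / (1 / a)) ^ ((j : ℝ) + 1) = a ^ (j + 1) := by
        rw [one_div_one_div]
        exact_mod_cast Real.rpow_natCast a (j + 1)
      rw [this]
      push_cast
      ring
    refine ⟨?_, h2⟩
    -- A non-integrable function has integral `0` by convention, but the value is positive.
    by_contra h
    rw [MeasureTheory.integral_undef h] at h2
    have : (0 : ℝ) < (j + 1).factorial * a ^ (j + 1) := by positivity
    linarith
  have hterm : ∀ t : ℕ, (((t + 1 : ℕ) : ℝ) ^ (j + 1) - (t : ℝ) ^ (j + 1)) *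
      Real.exp (-((t + 1 : ℕ) : ℝ) / a) ≤ ∫ x in (t : ℝ)..((t + 1 : ℕ) : ℝ), g x := fun t => by
    have ht : (t : ℝ) ≤ ((t + 1 : ℕ) : ℝ) := by push_cast; linarith
    have h1 : (((t + 1 : ℕ) : ℝ) ^ (j + 1) - (t : ℝ) ^ (j + 1)) * Real.exp (-((t + 1 : ℕ) : ℝ) / a)
        = ∫ x in (t : ℝ)..((t + 1 : ℕ) : ℝ),
          (j + 1) * x ^ j * Real.exp (-((t + 1 : ℕ) : ℝ) / a) := by
      rw [intervalIntegral.integral_mul_const, intervalIntegral.integral_const_mul, integral_pow]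
      field_simp
    rw [h1]
    refine intervalIntegral.integral_mono_on ht
      (Continuous.intervalIntegrable (by fun_prop) _ _) (hg.intervalIntegrable _ _) fun x hx => ?_
    have hx0 : 0 ≤ x := le_trans (by positivity) hx.1
    have := hx.2
    simp only [g]
    gcongr
  calc _ ≤ ∑ t ∈ Finset.Ico s S, ∫ x in (t : ℝ)..((t + 1 : ℕ) : ℝ), g x :=
        Finset.sum_le_sum fun t _ => hterm t
    _ = ∫ x in (s : ℝ)..(S : ℝ), g x :=
      intervalIntegral.sum_integral_adjacent_intervals_Ico (a := fun t : ℕ => (t : ℝ)) hsS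
        fun t _ => hg.intervalIntegrable _ _
    _ = ∫ x in Set.Ioc (s : ℝ) S, g x :=
      intervalIntegral.integral_of_le (by exact_mod_cast hsS)
    _ ≤ ∫ x in Set.Ioi 0, g x := by
      refine MeasureTheory.setIntegral_mono_set hint.1 ?_ ?_
      · refine (MeasureTheory.ae_restrict_mem measurableSet_Ioi).mono fun x hx => ?_
        have : (0 : ℝ) < x := hx
        simp only [g, Pi.zero_apply]
        positivity
      · exact Filter.Eventually.of_forall fun x hx => lt_of_le_of_lt (by positivity) hx.1
    _ = _ := hint.2

/-- Summation by parts over an increasing exhaustion of a finite type. -/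
theorem sum_le_of_exhaustion {F : Type*} [Fintype F] [DecidableEq F] {T : ℕ → Finset F}
    (hT : Monotone T) {u : F → ℝ} {w c : ℕ → ℝ} (hw : Antitone w) (hw1 : ∀ t, w t ≤ 1) {s : ℕ}
    (hu1 : ∀ f, u f ≤ 1) (hu : ∀ t, s ≤ t → ∀ f, f ∉ T t → u f ≤ w (t + 1))
    (hc : ∀ t, s ≤ t → ((T t).card : ℝ) ≤ c t) {S : ℕ} (hS : s ≤ S) :
    ∑ f ∈ T S, u f + (c S - (T S).card) * w S
      ≤ c s + ∑ t ∈ Finset.Ico s S, (c (t + 1) - c t) * w (t + 1) := by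
  -- The surplus term `(c S - (T S).card) * w S` carries the induction: the unused part of the count
  -- is moved to the smaller weight `w (S + 1)`.
  induction S, hS using Nat.le_induction with
  | base =>
    have h1 : ∑ f ∈ T s, u f ≤ (T s).card := by
      simpa using Finset.sum_le_sum fun f (_ : f ∈ T s) => hu1 f
    have h2 := mul_le_mul_of_nonneg_left (hw1 s) (sub_nonneg.2 (hc s le_rfl))
    simp only [Finset.Ico_self, Finset.sum_empty]
    linarith
  | succ S hS ih =>
    have hsub := hT (Nat.le_succ S)
    have h1 : ∑ f ∈ T (S + 1) \ T S, u f ≤ ((T (S + 1) \ T S).card : ℝ) * w (S + 1) := by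
      rw [← nsmul_eq_mul]
      exact Finset.sum_le_card_nsmul _ _ _ fun f hf => hu S hS f (Finset.mem_sdiff.1 hf).2
    have h2 : ((T (S + 1) \ T S).card : ℝ) = (T (S + 1)).card - (T S).card := by
      rw [Finset.card_sdiff_of_subset hsub, Nat.cast_sub (Finset.card_le_card hsub)]
    have h3 := Finset.sum_sdiff (f := u) hsub
    have h4 := mul_le_mul_of_nonneg_left (hw (Nat.le_succ S)) (sub_nonneg.2 (hc S hS))
    rw [Finset.sum_Ico_succ_top hS, ← h3]
    rw [h2] at h1
    simp only [Nat.succ_eq_add_one] at *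
    nlinarith

/-- The terms need not commute, hence ordered tuples and list products. -/
theorem sum_pow_eq_sum_list_prod {V R : Type*} [Fintype V] [Semiring R] (a : V → R) (M : ℕ) :
    (∑ i, a i) ^ M = ∑ f : Fin M → V, ((List.ofFn f).map a).prod := by
  induction M with
  | zero => simp
  | succ M ih =>
    rw [pow_succ', ih, Finset.sum_mul_sum, ← Finset.sum_product',
      ← (Fin.consEquiv fun _ => V).sum_comp]
    refine Finset.sum_congr rfl fun p _ => ?_
    simp [Fin.consEquiv, List.ofFn_succ]

end Tail

/-! ### Moments of local sums in a clustering state. -/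

section Moments

variable {V : Type*} [Fintype V] [DecidableEq V] {q : ℕ} [NeZero q] {G : SimpleGraph V}

omit [Fintype V] [DecidableEq V] in
theorem le_setDist {X Y : Set V} (hX : X.Nonempty) (hY : Y.Nonempty) {D : ℕ}
    (h : ∀ i ∈ X, ∀ j ∈ Y, D ≤ G.dist i j) : D ≤ setDist G X Y := by
  obtain ⟨i, hi⟩ := hX
  obtain ⟨j, hj⟩ := hY
  refine le_csInf ⟨_, i, hi, j, hj, rfl⟩ ?_
  rintro _ ⟨i, hi, j, hj, rfl⟩
  exact h i hi j hj

theorem norm_list_map_prod_le {a : V → Op V q} {C : ℝ} (hC : 0 ≤ C) (ha : ∀ i, ‖a i‖ ≤ C)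
    (L : List V) : ‖(L.map a).prod‖ ≤ C ^ L.length := by
  induction L with
  | nil => simp
  | cons i L ih =>
    rw [List.map_cons, List.prod_cons, List.length_cons, pow_succ']
    exact (norm_mul_le _ _).trans (mul_le_mul (ha i) ih (norm_nonneg _) hC)

/-- Correlations of products of centred local observables are small if one of the sites is
isolated from the others. -/
theorem norm_trace_mul_prod_le (hG : G.Connected) {ρ : Op V q} {r ξ : ℝ} (hξ : 0 < ξ)
    (hρ : IsClustering G ρ r ξ) {ℓ : ℕ} (hrℓ : r ≤ ℓ) {a : V → Op V q}
    (hsupp : ∀ i, IsSupportedOn (ball G i ℓ) (a i)) (hzero : ∀ i, (ρ * a i).trace = 0)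
    {C : ℝ} (hC : 0 ≤ C) (ha : ∀ i, ‖a i‖ ≤ C) {L₁ L₂ : List V} {i : V} (hne : L₁ ++ L₂ ≠ [])
    {D : ℕ} (hD : ∀ j ∈ L₁ ++ L₂, D ≤ G.dist i j) (hD3 : 3 * ℓ + 1 ≤ D) :
    ‖(ρ * ((L₁ ++ i :: L₂).map a).prod).trace‖
      ≤ C ^ (L₁ ++ i :: L₂).length * Real.exp (-(D : ℝ) / (3 * ξ)) := by
  set X := ball G i ℓ with hX
  set Y : Set V := {k | ∃ j ∈ L₁ ++ L₂, k ∈ ball G j ℓ} with hY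
  have hsub : ∀ j ∈ L₁ ++ L₂, IsSupportedOn Y (a j) := fun j hj =>
    (hsupp j).mono fun k hk => ⟨j, hj, hk⟩
  have hdist : ∀ x ∈ X, ∀ y ∈ Y, D - 2 * ℓ ≤ G.dist y x := by
    rintro x hx y ⟨j, hj, hy⟩
    have h1 := hD j hj
    have h2 : G.dist i j ≤ G.dist i x + G.dist x j := hG.dist_triangle
    have h3 : G.dist x j ≤ G.dist x y + G.dist y j := hG.dist_triangle
    have h4 : G.dist i x ≤ ℓ := hx
    have h5 : G.dist j y ≤ ℓ := hy
    rw [G.dist_comm] at h5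
    rw [G.dist_comm]
    omega
  have hXne : X.Nonempty := ⟨i, by simp [hX, ball]⟩
  obtain ⟨j, hj⟩ := List.exists_mem_of_ne_nil _ hne
  have hYne : Y.Nonempty := ⟨j, j, hj, by simp [ball]⟩
  have hYX : Y ⊆ Xᶜ := fun y hy hyX => by
    have := hdist y hyX y hy
    rw [SimpleGraph.dist_self] at this
    omega
  have hset : D - 2 * ℓ ≤ setDist G Y X := le_setDist hYne hXne fun y hy x hx => hdist x hx y hy
  have hP : IsSupportedOn Y (L₁.map a).prod := IsSupportedOn.list_prod fun A hA => by
    obtain ⟨j, hj, rfl⟩ := List.mem_map.1 hA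
    exact hsub j (List.mem_append_left _ hj)
  have hQ : IsSupportedOn Y (L₂.map a).prod := IsSupportedOn.list_prod fun A hA => by
    obtain ⟨j, hj, rfl⟩ := List.mem_map.1 hA
    exact hsub j (List.mem_append_right _ hj)
  have hcomm : Commute (a i) (L₂.map a).prod := (hsupp i).commute (hQ.mono hYX)
  have hprod : ρ * ((L₁ ++ i :: L₂).map a).prod = ρ * ((L₁ ++ L₂).map a).prod * a i := by
    rw [List.map_append, List.prod_append, List.map_cons, List.prod_cons, hcomm.eq,
      List.map_append, List.prod_append]
    simp only [mul_assoc]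
  have hrset : r ≤ (setDist G Y X : ℝ) :=
    hrℓ.trans (by exact_mod_cast (show ℓ ≤ setDist G Y X by omega))
  have hPQ : IsSupportedOn Y ((L₁ ++ L₂).map a).prod := by
    rw [List.map_append, List.prod_append]
    exact hP.mul hQ
  have key := hρ Y X _ (a i) hYne hXne hPQ (hsupp i) hrset
  rw [hzero i, mul_zero, sub_zero, ← hprod] at key
  refine key.trans (mul_le_mul ?_ ?_ (Real.exp_pos _).le (by positivity))
  · have hlen : (L₁ ++ i :: L₂).length = (L₁ ++ L₂).length + 1 := by
      simp only [List.length_append, List.length_cons]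
      omega
    rw [hlen, pow_succ]
    exact mul_le_mul (norm_list_map_prod_le hC ha _) (ha i) (norm_nonneg _) (by positivity)
  · rw [Real.exp_le_exp, neg_div, neg_div, neg_le_neg_iff, div_le_div_iff₀ (by positivity) hξ]
    -- The two radii use up `2 * ℓ` of the distance; as `D > 3 * ℓ`, at least a third of `D`
    -- remains, hence the decay rate `1 / (3 * ξ)`.
    have h3 : (D : ℝ) ≤ 3 * (setDist G Y X : ℝ) := by
      exact_mod_cast (show D ≤ 3 * setDist G Y X by omega)
    nlinarith

-- The remaining entries are indexed by positions, not sites: a repeated site is a neighbour at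
-- distance `0`.
omit [Fintype V] [DecidableEq V] in
theorem ofFn_eq_append_cons {M : ℕ} (f : Fin M → V) (k : Fin M) :
    ∃ L₁ L₂ : List V, List.ofFn f = L₁ ++ f k :: L₂ ∧ ∀ j ∈ L₁ ++ L₂, ∃ l, l ≠ k ∧ f l = j := by
  refine ⟨(List.ofFn f).take k, (List.ofFn f).drop (k + 1), ?_, fun j hj => ?_⟩
  · have hk : (k : ℕ) < (List.ofFn f).length := by simp
    have : f k = (List.ofFn f)[(k : ℕ)] := by simp
    rw [this, List.cons_getElem_drop_succ, List.take_append_drop]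
  · rcases List.mem_append.1 hj with hj | hj
    · obtain ⟨l, hl, rfl⟩ := List.mem_take_iff_getElem.1 hj
      simp only [List.length_ofFn, lt_min_iff] at hl
      exact ⟨⟨l, hl.2⟩, by simp [Fin.ext_iff]; omega, by simp⟩
    · obtain ⟨l, hl, rfl⟩ := List.mem_drop_iff_getElem.1 hj
      simp only [List.length_ofFn] at hl
      exact ⟨⟨_, hl⟩, by simp [Fin.ext_iff]; omega, by simp [add_comm]⟩

open Classical in
omit [DecidableEq V] in
theorem card_dist_le {d : ℕ} {α : ℝ} (hgrow : HasGrowth G d α) {s : ℕ} (hs : 1 ≤ s) (i : V) :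
    (({j | G.dist i j ≤ s} : Finset V).card : ℝ) ≤ α * (s : ℝ) ^ d := by
  have h : ball G i s = (({j | G.dist i j ≤ s} : Finset V) : Set V) := by
    ext
    simp [ball]
  have := hgrow i s hs
  rwa [h, Set.ncard_coe_finset] at this

/-- The bound on the central moments of a sum of local observables in a clustering state. -/
noncomputable def momentScale (d : ℕ) (α ξ : ℝ) (n ℓ m : ℕ) : ℝ :=
  16 * α * n * m * max ((3 * ξ * d * m / 2) ^ d) ((3 * ℓ : ℝ) ^ d)

theorem norm_trace_mul_sum_pow_le (hG : G.Connected) {d : ℕ} (hd : 1 ≤ d) {α : ℝ} (hα : 0 < α)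
    (hgrow : HasGrowth G d α) {ρ : Op V q} {r ξ : ℝ} (hξ : 0 < ξ)
    (hρ : IsClustering G ρ r ξ) (hρ1 : ∀ A, ‖(ρ * A).trace‖ ≤ ‖A‖)
    {ℓ : ℕ} (hℓ : 1 ≤ ℓ) (hrℓ : r ≤ ℓ) {a : V → Op V q}
    (hsupp : ∀ i, IsSupportedOn (ball G i ℓ) (a i)) (hzero : ∀ i, (ρ * a i).trace = 0)
    (ha : ∀ i, ‖a i‖ ≤ 2) {m : ℕ} (hm : 1 ≤ m) :
    ‖(ρ * (∑ i, a i) ^ (2 * m)).trace‖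
      ≤ 3 * momentScale d α ξ (Fintype.card V) ℓ m ^ m := by
  classical
  set n := Fintype.card V
  let T : ℕ → Finset (Fin (2 * m) → V) := fun s =>
    {f | ∀ k, ∃ l, l ≠ k ∧ G.dist (f k) (f l) ≤ s}
  have hTmono : Monotone T := fun s t hst f hf => by
    simp only [T, Finset.mem_filter, Finset.mem_univ, true_and] at hf ⊢
    exact fun k => (hf k).imp fun l h => ⟨h.1, h.2.trans hst⟩
  -- Dividing by `4 ^ m = 2 ^ (2 * m)`, the product of the norm bounds, makes every term at most
  -- `1`.
  let u : (Fin (2 * m) → V) → ℝ := fun f => ‖(ρ * ((List.ofFn f).map a).prod).trace‖ / 4 ^ m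
  let w : ℕ → ℝ := fun t => Real.exp (-(t : ℝ) / (3 * ξ))
  let c : ℕ → ℝ := fun t => (4 * (n * (m * α))) ^ m * (t : ℝ) ^ (d * m)
  have hw : Antitone w := fun s t hst => by
    simp only [w]
    gcongr
  have hw1 : ∀ t, w t ≤ 1 := fun t => by
    simp only [w, Real.exp_le_one_iff]
    exact div_nonpos_of_nonpos_of_nonneg (by simp) (by positivity)
  have h42 : (4 : ℝ) ^ m = 2 ^ (2 * m) := by rw [pow_mul]; norm_num
  have hu1 : ∀ f, u f ≤ 1 := fun f => by
    simp only [u]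
    rw [div_le_one (by positivity), h42]
    refine (hρ1 _).trans ((norm_list_map_prod_le zero_le_two ha _).trans ?_)
    simp
  -- Outside `T t` some site is at distance at least `t + 1` from the others; this integer step
  -- gives both `w (t + 1)` and `D ≥ 3 * ℓ + 1`.
  have hu : ∀ t, 3 * ℓ ≤ t → ∀ f, f ∉ T t → u f ≤ w (t + 1) := fun t ht f hf => by
    simp only [T, Finset.mem_filter, Finset.mem_univ, true_and, not_forall, not_exists, not_and,
      not_le] at hf
    obtain ⟨k, hk⟩ := hf
    obtain ⟨L₁, L₂, hL, hmem⟩ := ofFn_eq_append_cons f k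
    have hlen : (L₁ ++ f k :: L₂).length = 2 * m := by rw [← hL]; simp
    simp only [u, w]
    rw [div_le_iff₀' (by positivity), h42, hL, ← hlen]
    refine norm_trace_mul_prod_le hG hξ hρ hrℓ hsupp hzero zero_le_two ha ?_ ?_ (by omega)
    · intro h
      have := congrArg List.length h
      simp only [List.length_append, List.length_cons, List.length_nil] at this hlen
      omega
    · intro j hj
      obtain ⟨l, hl, rfl⟩ := hmem j hj
      exact hk l hl
  have hc : ∀ t, 3 * ℓ ≤ t → ((T t).card : ℝ) ≤ c t := fun t ht => by
    have := card_no_isolated_le (fun i j => G.dist i j ≤ t)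
      (fun i j h => by rwa [G.dist_comm]) (b := α * (t : ℝ) ^ d) (by positivity)
      (fun i => by convert card_dist_le hgrow (show 1 ≤ t by omega) i) m
    refine (le_of_eq (by simp only [T]; congr!)).trans (this.trans (le_of_eq ?_))
    simp only [c]
    rw [pow_mul, ← mul_pow]
    ring
  obtain ⟨S₀, hS₀⟩ : ∃ S₀ : ℕ, ∀ i j, G.dist i j ≤ S₀ :=
    ⟨Finset.univ.sup fun p : V × V => G.dist p.1 p.2,
      fun i j => Finset.le_sup (f := fun p : V × V => G.dist p.1 p.2) (Finset.mem_univ (i, j))⟩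
  set S := max S₀ (3 * ℓ)
  have hTS : T S = Finset.univ := by
    ext f
    simp only [T, Finset.mem_filter, Finset.mem_univ, true_and, iff_true]
    intro k
    have : Nontrivial (Fin (2 * m)) := Fin.nontrivial_iff_two_le.2 (by omega)
    obtain ⟨l, hl⟩ := exists_ne k
    exact ⟨l, hl, (hS₀ _ _).trans (le_max_left _ _)⟩
  have hS : 3 * ℓ ≤ S := le_max_right _ _
  have key := sum_le_of_exhaustion hTmono hw hw1 hu1 hu hc hS
  have htail := sum_pow_sub_pow_mul_exp_le (a := 3 * ξ) (by positivity) (d * m)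
    (Nat.mul_pos hd hm) hS
  have hfac := factorial_le_two_mul_half_pow (d * m)
  have hrem : 0 ≤ (c S - (T S).card) * w S :=
    mul_nonneg (sub_nonneg.2 (hc S hS)) (Real.exp_pos _).le
  set Mx := max ((3 * ξ * d * m / 2) ^ d) ((3 * ℓ : ℝ) ^ d)
  have hMx0 : 0 ≤ Mx := le_max_of_le_right (by positivity)
  -- The factor `3` is `1` from scales up to `3 * ℓ` plus `2` from the factorial bound in the tail.
  have hsum : ∑ f, u f ≤ (4 * (n * (m * α))) ^ m * (3 * Mx ^ m) := by
    have h1 : ∑ t ∈ Finset.Ico (3 * ℓ) S, (c (t + 1) - c t) * w (t + 1)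
        ≤ (4 * (n * (m * α))) ^ m * (2 * Mx ^ m) := by
      calc _ = (4 * (n * (m * α))) ^ m * ∑ t ∈ Finset.Ico (3 * ℓ) S,
            (((t + 1 : ℕ) : ℝ) ^ (d * m) - (t : ℝ) ^ (d * m))
              * Real.exp (-((t + 1 : ℕ) : ℝ) / (3 * ξ)) := by
            rw [Finset.mul_sum]
            refine Finset.sum_congr rfl fun t _ => ?_
            simp only [c, w]
            ring
        _ ≤ (4 * (n * (m * α))) ^ m * ((d * m).factorial * (3 * ξ) ^ (d * m)) := by gcongr
        _ ≤ (4 * (n * (m * α))) ^ m * (2 * (((d * m : ℕ) : ℝ) / 2) ^ (d * m) *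
            (3 * ξ) ^ (d * m)) := by gcongr
        _ = (4 * (n * (m * α))) ^ m * (2 * ((3 * ξ * d * m / 2) ^ d) ^ m) := by
          rw [mul_assoc 2, ← mul_pow, ← pow_mul]
          push_cast
          ring
        _ ≤ _ := by
          gcongr
          exact le_max_left _ _
    have h2 : c (3 * ℓ) ≤ (4 * (n * (m * α))) ^ m * Mx ^ m := by
      simp only [c]
      rw [pow_mul]
      push_cast
      gcongr
      exact le_max_right _ _
    rw [hTS] at key hrem
    linarith
  calc ‖(ρ * (∑ i, a i) ^ (2 * m)).trace‖
      = ‖∑ f : Fin (2 * m) → V, (ρ * ((List.ofFn f).map a).prod).trace‖ := by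
        rw [sum_pow_eq_sum_list_prod, Finset.mul_sum, Matrix.trace_sum]
    _ ≤ ∑ f : Fin (2 * m) → V, ‖(ρ * ((List.ofFn f).map a).prod).trace‖ := norm_sum_le _ _
    _ = 4 ^ m * ∑ f, u f := by
      rw [Finset.mul_sum]
      refine Finset.sum_congr rfl fun f _ => ?_
      simp only [u]
      field_simp
    _ ≤ 4 ^ m * ((4 * (n * (m * α))) ^ m * (3 * Mx ^ m)) := by gcongr
    _ = _ := by
      rw [mul_left_comm _ 3, mul_left_comm _ 3, ← mul_pow, ← mul_pow, momentScale]
      ring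

theorem average_sub_pow_le {κ : Type*} [Fintype κ] [Nonempty κ]
    {H : Op V q} {ψ : OrthonormalBasis κ ℂ (EuclideanSpace ℂ (V → Fin q))} {En : κ → ℝ}
    (hψ : ∀ m, Matrix.toEuclideanLin H (ψ m) = (En m : ℂ) • ψ m) {β : ℝ}
    (hG : G.Connected) {d : ℕ} (hd : 1 ≤ d) {α : ℝ} (hα : 0 < α)
    (hgrow : HasGrowth G d α) {r ξ : ℝ} (hξ : 0 < ξ)
    (hρ : IsClustering G (gibbs H β) r ξ) {ℓ : ℕ} (hℓ : 1 ≤ ℓ) (hrℓ : r ≤ ℓ)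
    {ω : V → Op V q} (hω : IsLocalFamily G ℓ ω) {m : ℕ} (hm : 1 ≤ m) :
    average (gibbs H β)
        ((∑ i, ω i - (average (gibbs H β) (∑ i, ω i) : ℂ) • (1 : Op V q)) ^ (2 * m))
      ≤ 3 * momentScale d α ξ (Fintype.card V) ℓ m ^ m := by
  set ρ := gibbs H β with hρdef
  let a : V → Op V q := fun i => ω i - (average ρ (ω i) : ℂ) • (1 : Op V q)
  have hsum : ∑ i, ω i - (average ρ (∑ i, ω i) : ℂ) • (1 : Op V q) = ∑ i, a i := by
    have : average ρ (∑ i, ω i) = ∑ i, average ρ (ω i) := by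
      simp only [average, Finset.mul_sum, Matrix.trace_sum, Complex.re_sum]
    rw [this]
    simp only [a, Finset.sum_sub_distrib, ← Finset.sum_smul]
    push_cast
    rfl
  have hρ1 : ∀ A, ‖(ρ * A).trace‖ ≤ ‖A‖ := norm_trace_gibbs_mul_le hψ β
  rw [hsum]
  refine (Complex.re_le_norm _).trans (norm_trace_mul_sum_pow_le hG hd hα hgrow hξ hρ hρ1 hℓ hrℓ
    (fun i => (hω.supported i).sub_smul_one _) (fun i => ?_) (fun i => ?_) hm)
  · rw [Matrix.mul_sub, Matrix.trace_sub, hρdef, trace_gibbs_mul_hermitian hψ β (hω.hermitian i),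
      Matrix.mul_smul, Matrix.trace_smul, mul_one, trace_gibbs hψ]
    simp
  · refine (norm_sub_le _ _).trans ?_
    have h1 := hω.norm_le i
    -- Centring at most doubles the norm bound, whence the `2` in `ha`.
    have h2 : ‖(average ρ (ω i) : ℂ) • (1 : Op V q)‖ ≤ 1 := by
      rw [norm_smul, norm_one, mul_one, Complex.norm_real]
      exact (Complex.abs_re_le_norm _).trans ((hρ1 _).trans h1)
    linarith

end Moments

theorem sum_biUnion_le {ι κ : Type*} [DecidableEq ι] [DecidableEq κ] (s : Finset ι)
    (t : ι → Finset κ) {f : κ → ℝ} (hf : ∀ k, 0 ≤ f k) :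
    ∑ k ∈ s.biUnion t, f k ≤ ∑ i ∈ s, ∑ k ∈ t i, f k := by
  induction s using Finset.induction_on with
  | empty => simp
  | insert i s hi ih =>
    rw [Finset.biUnion_insert, Finset.sum_insert hi]
    have h1 := Finset.sum_union_inter (s₁ := t i) (s₂ := s.biUnion t) (f := f)
    have h2 : 0 ≤ ∑ k ∈ t i ∩ s.biUnion t, f k := Finset.sum_nonneg fun k _ => hf k
    linarith

/-! ### From the canonical weights to the energy shell. -/

section Shell

variable {N : ℕ} {En : Fin N → ℝ} {β Δ E : ℝ}

open Classical in
theorem shellDistribution_real (x : Fin N → ℝ) (S : Set ℝ) :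
    (shellDistribution En x E Δ).real S
      = ((shell En E Δ).card : ℝ)⁻¹ * ((shell En E Δ).filter fun m => x m ∈ S).card := by
  rw [MeasureTheory.Measure.real, shellDistribution, MeasureTheory.Measure.smul_apply,
    MeasureTheory.Measure.finsetSum_apply, smul_eq_mul, ENNReal.toReal_mul, ENNReal.toReal_inv,
    ENNReal.toReal_natCast]
  congr 1
  have : ∑ m ∈ shell En E Δ, MeasureTheory.Measure.dirac (x m) S
      = (((shell En E Δ).filter fun m => x m ∈ S).card : ENNReal) := by
    simp [MeasureTheory.Measure.dirac_apply, Set.indicator_apply]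
  rw [this, ENNReal.toReal_natCast]

theorem shellDistribution_real_le_one (x : Fin N → ℝ) (S : Set ℝ) :
    (shellDistribution En x E Δ).real S ≤ 1 := by
  classical
  rw [shellDistribution_real]
  rcases Nat.eq_zero_or_pos (shell En E Δ).card with h | h
  · simp [h]
  rw [inv_mul_le_iff₀ (by exact_mod_cast h), mul_one]
  exact_mod_cast Finset.card_filter_le _ _

/-- The partition function is controlled by the weight of the dominating shell, if the variance of
the energy is bounded. -/
theorem boltzmannSum_le (hβ : 0 ≤ β) (hΔ : 0 < Δ)
    (hmax : ∀ E' : ℝ, Real.exp (-β * E') * ((shell En E' Δ).card : ℝ)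
      ≤ Real.exp (-β * E) * ((shell En E Δ).card : ℝ)) {c w : ℝ} (hw : 0 < w)
    (hvar : ∑ m, Real.exp (-β * En m) * (En m - c) ^ 2 ≤ boltzmannSum En β * (w ^ 2 / 4)) :
    boltzmannSum En β ≤ 4 / 3 * (1 + 2 * w / Δ)
      * (Real.exp (β * Δ) * (Real.exp (-β * E) * ((shell En E Δ).card : ℝ))) := by
  classical
  set W := Real.exp (-β * E) * ((shell En E Δ).card : ℝ)
  set K := ⌈2 * w / Δ⌉₊
  have hshell : ∀ E', ∑ m ∈ shell En E' Δ, Real.exp (-β * En m) ≤ Real.exp (β * Δ) * W := by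
    intro E'
    calc ∑ m ∈ shell En E' Δ, Real.exp (-β * En m)
        ≤ ∑ m ∈ shell En E' Δ, Real.exp (β * Δ) * Real.exp (-β * E') := by
          refine Finset.sum_le_sum fun m hm => ?_
          have : E' - Δ < En m := by
            simp only [shell, Finset.mem_filter] at hm
            exact hm.2.1
          rw [← Real.exp_add, Real.exp_le_exp]
          nlinarith
      _ = Real.exp (β * Δ) * (Real.exp (-β * E') * ((shell En E' Δ).card : ℝ)) := by
        rw [Finset.sum_const, nsmul_eq_mul]
        ring
      _ ≤ _ := by
        gcongr
        exact hmax E'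
  -- Consecutive shells tile the window of width `2 * w`. Its left end is excluded, so the ceiling
  -- below is at least `1` and `j` starts at `0`.
  have hcover : ({m | |En m - c| < w} : Finset (Fin N)) ⊆
      (Finset.range K).biUnion fun j : ℕ => shell En (c - w + (j + 1) * Δ) Δ := fun m hm => by
    simp only [Finset.mem_filter, Finset.mem_univ, true_and, abs_lt] at hm
    have hpos : 0 < (En m - (c - w)) / Δ := div_pos (by linarith) hΔ
    have hlt : (En m - (c - w)) / Δ ≤ 2 * w / Δ := by gcongr; linarith
    obtain ⟨j, hj⟩ : ∃ j, ⌈(En m - (c - w)) / Δ⌉₊ = j + 1 :=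
      ⟨_, (Nat.succ_pred_eq_of_pos (Nat.ceil_pos.2 hpos)).symm⟩
    have h1 := Nat.le_ceil ((En m - (c - w)) / Δ)
    have h2 := Nat.ceil_lt_add_one hpos.le
    have h3 : ⌈(En m - (c - w)) / Δ⌉₊ ≤ K := Nat.ceil_mono hlt
    rw [hj] at h1 h2 h3
    push_cast at h1 h2
    rw [div_le_iff₀ hΔ] at h1
    rw [add_lt_add_iff_right, lt_div_iff₀ hΔ] at h2
    simp only [Finset.mem_biUnion, Finset.mem_range, shell, Finset.mem_filter, Finset.mem_univ,
      true_and, Set.mem_Ioc]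
    exact ⟨j, by omega, by linarith, by linarith⟩
  have hin : ∑ m with |En m - c| < w, Real.exp (-β * En m) ≤ K * (Real.exp (β * Δ) * W) := by
    calc _ ≤ ∑ m ∈ (Finset.range K).biUnion fun j : ℕ => shell En (c - w + (j + 1) * Δ) Δ,
          Real.exp (-β * En m) :=
          Finset.sum_le_sum_of_subset_of_nonneg hcover fun _ _ _ => (Real.exp_pos _).le
      _ ≤ ∑ j ∈ Finset.range K, ∑ m ∈ shell En (c - w + (j + 1) * Δ) Δ, Real.exp (-β * En m) :=
        sum_biUnion_le _ _ fun _ => (Real.exp_pos _).le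
      _ ≤ ∑ j ∈ Finset.range K, Real.exp (β * Δ) * W := Finset.sum_le_sum fun j _ => hshell _
      _ = _ := by simp
  -- Chebyshev's inequality: at most a quarter of the weight lies outside the window, which yields
  -- the factor `4 / 3`.
  have hout : w ^ 2 * ∑ m with ¬ |En m - c| < w, Real.exp (-β * En m)
      ≤ boltzmannSum En β * (w ^ 2 / 4) := by
    refine le_trans ?_ hvar
    rw [Finset.mul_sum]
    refine (Finset.sum_le_sum fun m hm => ?_).trans (Finset.sum_le_sum_of_subset_of_nonneg
      (Finset.filter_subset _ _) fun _ _ _ => by positivity)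
    simp only [Finset.mem_filter, Finset.mem_univ, true_and, not_lt] at hm
    have : w ^ 2 ≤ (En m - c) ^ 2 := by
      rw [← sq_abs (En m - c)]
      gcongr
    rw [mul_comm]
    gcongr
  have hsplit : boltzmannSum En β = _ :=
    (Finset.sum_filter_add_sum_filter_not Finset.univ (fun m => |En m - c| < w)
      fun m => Real.exp (-β * En m)).symm
  have hout' : ∑ m with ¬ |En m - c| < w, Real.exp (-β * En m) ≤ boltzmannSum En β / 4 := by
    have : 0 < w ^ 2 := by positivity
    refine le_of_mul_le_mul_left (hout.trans (le_of_eq ?_)) this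
    ring
  have hK : (K : ℝ) ≤ 1 + 2 * w / Δ := by
    have := (Nat.ceil_lt_add_one (show 0 ≤ 2 * w / Δ by positivity)).le
    linarith
  have hKW : K * (Real.exp (β * Δ) * W) ≤ (1 + 2 * w / Δ) * (Real.exp (β * Δ) * W) := by
    gcongr
  linarith

/-- Markov's inequality in the shell, from a moment bound for the canonical weights. -/
theorem shellDistribution_real_le (hβ : 0 ≤ β)
    (hpos : 0 < (shell En E Δ).card) {x : Fin N → ℝ} {c x₀ M Q : ℝ} (hx₀ : 0 < x₀) {m : ℕ}
    (hM : 0 ≤ M)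
    (hmom : ∑ k, Real.exp (-β * En k) * (x k - c) ^ (2 * m) ≤ boltzmannSum En β * M)
    (hZ : boltzmannSum En β ≤ Q * (Real.exp (-β * E) * ((shell En E Δ).card : ℝ))) :
    (shellDistribution En x E Δ).real {y | x₀ ≤ |y - c|} ≤ Q * (M / x₀ ^ (2 * m)) := by
  classical
  have hpos' : (0 : ℝ) < (shell En E Δ).card := by exact_mod_cast hpos
  rw [shellDistribution_real, inv_mul_le_iff₀ hpos']
  set B := (shell En E Δ).filter fun k => x k ∈ {y : ℝ | x₀ ≤ |y - c|}
  have h1 : (B.card : ℝ) * (Real.exp (-β * E) * x₀ ^ (2 * m))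
      ≤ ∑ k, Real.exp (-β * En k) * (x k - c) ^ (2 * m) := by
    rw [← nsmul_eq_mul]
    refine (Finset.card_nsmul_le_sum B (fun k => Real.exp (-β * En k) * (x k - c) ^ (2 * m)) _
      fun k hk => ?_).trans (Finset.sum_le_sum_of_subset_of_nonneg (Finset.subset_univ _)
        fun k _ _ => mul_nonneg (Real.exp_pos _).le ((even_two_mul m).pow_nonneg _))
    obtain ⟨hk1, hk2⟩ := Finset.mem_filter.1 hk
    have hE : En k ≤ E := by
      simp only [shell, Finset.mem_filter] at hk1
      exact hk1.2.2
    have hk3 : x₀ ≤ |x k - c| := hk2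
    rw [← (even_two_mul m).pow_abs (x k - c)]
    refine mul_le_mul (Real.exp_le_exp.2 ?_) (by gcongr) (by positivity) (by positivity)
    nlinarith
  have h2 := h1.trans (hmom.trans (mul_le_mul_of_nonneg_right hZ hM))
  have hexp := Real.exp_pos (-β * E)
  rw [← mul_div_assoc, ← mul_div_assoc, le_div_iff₀ (by positivity)]
  refine le_of_mul_le_mul_left ?_ hexp
  linarith

end Shell

/-! ### Choice of the order of the moment. -/

section Scales

variable {d n ℓ m : ℕ} {α ξ x₀ : ℝ}

theorem momentScale_nonneg (hα : 0 < α) : 0 ≤ momentScale d α ξ n ℓ m :=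
  mul_nonneg (by positivity) (le_max_of_le_right (by positivity))

/-- The constants `c1` and `c2` are calibrated so that the two upper bounds on `m` correspond to the
two branches of the maximum in `momentScale`. -/
theorem momentScale_div_sq_le (hd : 1 ≤ d) (hα : 0 < α) (hξ : 0 < ξ) (hn : 0 < n) (hℓ : 1 ≤ ℓ)
    (hx₀ : 0 < x₀)
    (h1 : (m : ℝ) ≤ (x₀ ^ 2 / (c1 d α ξ * n)) ^ (1 / ((d : ℝ) + 1)))
    (h2 : (m : ℝ) ≤ x₀ ^ 2 / (c2 d α * (ℓ : ℝ) ^ d * n)) :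
    momentScale d α ξ n ℓ m / x₀ ^ 2 ≤ Real.exp (-1) := by
  have hd' : (0 : ℝ) < d := by exact_mod_cast hd
  have hn' : (0 : ℝ) < n := by exact_mod_cast hn
  have hℓ' : (0 : ℝ) < ℓ := by exact_mod_cast hℓ
  have he := Real.exp_pos 1
  have hc1 : 0 < c1 d α ξ := by
    unfold c1
    positivity
  have hc2 : 0 < c2 d α := by
    unfold c2
    positivity
  have h1' : (m : ℝ) ^ (d + 1) * (c1 d α ξ * n) ≤ x₀ ^ 2 := by
    have h := pow_le_pow_left₀ (by positivity) h1 (d + 1)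
    have e : ((x₀ ^ 2 / (c1 d α ξ * n)) ^ (1 / ((d : ℝ) + 1))) ^ (d + 1)
        = x₀ ^ 2 / (c1 d α ξ * n) := by
      rw [one_div]
      have := Real.rpow_inv_natCast_pow (x := x₀ ^ 2 / (c1 d α ξ * n)) (by positivity)
        (Nat.succ_ne_zero d)
      push_cast at this
      exact this
    rwa [e, le_div_iff₀ (by positivity)] at h
  have h2' : (m : ℝ) * (c2 d α * (ℓ : ℝ) ^ d * n) ≤ x₀ ^ 2 := by
    rwa [le_div_iff₀ (by positivity)] at h2
  rw [div_le_iff₀ (by positivity), Real.exp_neg, inv_mul_eq_div, le_div_iff₀ he, momentScale,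
    mul_max_of_nonneg _ _ (by positivity), max_mul_of_nonneg _ _ he.le]
  refine max_le (le_trans (le_of_eq ?_) h1') (le_trans (le_of_eq ?_) h2')
  · rw [c1, show 3 * ξ * d * m / 2 = 3 * ξ * d / 2 * m by ring, mul_pow]
    ring
  · rw [c2, mul_pow]
    ring

theorem exp_neg_floor_min_le {y₁ y₂ : ℝ} :
    Real.exp (-(⌊min y₁ y₂⌋₊ : ℝ)) ≤ Real.exp 1 * max (Real.exp (-y₁)) (Real.exp (-y₂)) := by
  have h : max (Real.exp (-y₁)) (Real.exp (-y₂)) = Real.exp (-min y₁ y₂) := by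
    rw [← Real.exp_monotone.map_max, max_neg_neg]
  rw [h, ← Real.exp_add, Real.exp_le_exp]
  linarith [Nat.lt_floor_add_one (min y₁ y₂)]

end Scales

end QSpin

/-! ### Assembly of the tail bound. -/

theorem proposition1 (d : ℕ) (hd : 1 ≤ d) (α ξ L : ℝ) (hα : 0 < α) (hξ : 0 < ξ) :
    ∃ C₁ : ℝ, 0 < C₁ ∧
      ∀ (V : Type*) [Fintype V] [DecidableEq V] (G : SimpleGraph V) (q : ℕ) [NeZero q],
        G.Connected → QSpin.HasGrowth G d α →
      ∀ (ℓ₀ ℓ : ℕ) (r : ℝ), max (ℓ₀ : ℝ) r ≤ L → 1 ≤ ℓ → r ≤ (ℓ : ℝ) →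
      ∀ (h ω : V → QSpin.Op V q) (H Ω : QSpin.Op V q),
        QSpin.IsLocalFamily G ℓ₀ h → H = ∑ i, h i →
        QSpin.IsLocalFamily G ℓ ω → Ω = ∑ i, ω i →
      ∀ (ψ : OrthonormalBasis (Fin (q ^ Fintype.card V)) ℂ (EuclideanSpace ℂ (V → Fin q)))
        (En : Fin (q ^ Fintype.card V) → ℝ),
        (∀ m, Matrix.toEuclideanLin H (ψ m) = (En m : ℂ) • ψ m) →
      ∀ β Δ E : ℝ, 0 ≤ β → 0 < Δ →
        (∀ E' : ℝ, Real.exp (-β * E') * ((QSpin.shell En E' Δ).card : ℝ)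
          ≤ Real.exp (-β * E) * ((QSpin.shell En E Δ).card : ℝ)) →
        QSpin.IsClustering G (QSpin.gibbs H β) r ξ →
      ∀ x₀ : ℝ, 0 < x₀ →
        (QSpin.shellDistribution En (fun m => QSpin.expect Ω (ψ m)) E Δ).real
            {x : ℝ | x₀ ≤ |x - QSpin.average (QSpin.gibbs H β) Ω|}
          ≤ min 1 (QSpin.CDelta C₁ β Δ ξ (Fintype.card V) *
              max
                (Real.exp (-((x₀ ^ 2 / (QSpin.c1 d α ξ * (Fintype.card V : ℝ)))
                  ^ (1 / ((d : ℝ) + 1)))))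
                (Real.exp (-(x₀ ^ 2
                  / (QSpin.c2 d α * (ℓ : ℝ) ^ d * (Fintype.card V : ℝ)))))) := by
  -- A radius that dominates `ℓ₀` and `r` and depends on `L` only; `K` then bounds the variance of
  -- `H` per site, independently of `ℓ`.
  set ℓ₁ : ℕ := max 1 ⌈L⌉₊ with hℓ₁
  set K : ℝ := 3 * QSpin.momentScale d α ξ 1 ℓ₁ 1 with hK
  have hK0 : 0 < K := by
    have : (1 : ℝ) ≤ ℓ₁ := by exact_mod_cast le_max_left _ _
    rw [hK, QSpin.momentScale]
    refine mul_pos three_pos (mul_pos (by push_cast; positivity) (lt_max_of_lt_right ?_))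
    positivity
  refine ⟨8 * √K, by positivity, ?_⟩
  intro V _ _ G q _ hG hgrow ℓ₀ ℓ r hL hℓ hrℓ h ω H Ω hh hH hω hΩ ψ En hψ β Δ E hβ hΔ hmax hclus
    x₀ hx₀
  refine le_min (QSpin.shellDistribution_real_le_one _ _) ?_
  have hn0 : 0 < Fintype.card V := by
    have := hG.nonempty
    exact Fintype.card_pos
  have hn' : (0 : ℝ) < Fintype.card V := by exact_mod_cast hn0
  have : Nonempty (Fin (q ^ Fintype.card V)) := ⟨⟨0, pow_pos (Nat.pos_of_ne_zero (NeZero.ne q)) _⟩⟩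
  have hZ0 := QSpin.boltzmannSum_pos (En := En) β
  have hΩh : Ω.IsHermitian := hΩ ▸ isSelfAdjoint_sum _ fun i _ => hω.hermitian i
  have hHh : H.IsHermitian := hH ▸ isSelfAdjoint_sum _ fun i _ => hh.hermitian i
  have hceil : L ≤ ℓ₁ := (Nat.le_ceil L).trans (by exact_mod_cast le_max_right _ _)
  have hℓ₀ : ℓ₀ ≤ ℓ₁ := by exact_mod_cast ((le_max_left _ _).trans hL).trans hceil
  have hh' : QSpin.IsLocalFamily G ℓ₁ h :=
    ⟨hh.hermitian, hh.norm_le, fun i => (hh.supported i).mono fun j hj => le_trans hj hℓ₀⟩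
  -- Chosen so that `w ^ 2 / 4` is the variance bound `K * n`.
  set w := 2 * √(K * Fintype.card V) with hw
  have hw0 : 0 < w := by positivity
  have hZ := QSpin.boltzmannSum_le hβ hΔ hmax (c := QSpin.average (QSpin.gibbs H β) H) hw0 (by
    have h1 := QSpin.sum_exp_mul_expect_sub_pow_le hψ β hHh (QSpin.average (QSpin.gibbs H β) H) 1
    have h2 := QSpin.average_sub_pow_le hψ hG hd hα hgrow hξ hclus (ℓ := ℓ₁) (le_max_left _ _)
      (((le_max_right _ _).trans hL).trans hceil) hh' le_rfl
    rw [← hH] at h2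
    have h3 := h1.trans h2
    rw [inv_mul_le_iff₀ hZ0] at h3
    have h4 : ∀ m, QSpin.expect H (ψ m) = En m := fun m => by
      rw [QSpin.expect, hψ, inner_smul_right, inner_self_eq_norm_sq_to_K, ψ.norm_eq_one]
      simp
    simp only [h4] at h3
    refine h3.trans (le_of_eq ?_)
    rw [hw, mul_pow, Real.sq_sqrt (by positivity), hK, QSpin.momentScale, QSpin.momentScale]
    push_cast
    ring)
  -- An empty maximal shell would force `Z ≤ 0`.
  have hcard : 0 < (QSpin.shell En E Δ).card := by
    by_contra hneg
    have h0 : (QSpin.shell En E Δ).card = 0 := by omega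
    rw [h0, Nat.cast_zero, mul_zero, mul_zero, mul_zero] at hZ
    linarith
  rw [← mul_assoc] at hZ
  set Q := 4 / 3 * (1 + 2 * w / Δ) * Real.exp (β * Δ) with hQ
  set y₁ := (x₀ ^ 2 / (QSpin.c1 d α ξ * (Fintype.card V : ℝ))) ^ (1 / ((d : ℝ) + 1)) with hy₁
  set y₂ := x₀ ^ 2 / (QSpin.c2 d α * (ℓ : ℝ) ^ d * (Fintype.card V : ℝ)) with hy₂
  have hQ' : 3 * Q = 2 * Real.exp (β * Δ) * (2 + 8 * √K * √(Fintype.card V : ℝ) / Δ) := by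
    rw [hQ, hw, Real.sqrt_mul hK0.le]
    ring
  have hexp1 : 1 ≤ Real.exp (β * Δ) := Real.one_le_exp (by positivity)
  have hmain : (QSpin.shellDistribution En (fun m => QSpin.expect Ω (ψ m)) E Δ).real
      {x : ℝ | x₀ ≤ |x - QSpin.average (QSpin.gibbs H β) Ω|}
        ≤ 3 * Q * Real.exp (-(⌊min y₁ y₂⌋₊ : ℝ)) := by
    -- The moment bound needs `m ≥ 1`; for `m = 0` the claim is trivial because `3 * Q ≥ 1`.
    rcases Nat.eq_zero_or_pos ⌊min y₁ y₂⌋₊ with h0 | hpos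
    · refine (QSpin.shellDistribution_real_le_one _ _).trans ?_
      rw [h0, Nat.cast_zero, neg_zero, Real.exp_zero, mul_one, hQ']
      have : 0 ≤ 8 * √K * √(Fintype.card V : ℝ) / Δ := by positivity
      nlinarith
    · set m := ⌊min y₁ y₂⌋₊
      have hm : (m : ℝ) ≤ min y₁ y₂ := Nat.floor_le (le_of_lt (Nat.pos_of_floor_pos hpos))
      have h1 := QSpin.sum_exp_mul_expect_sub_pow_le hψ β hΩh
        (QSpin.average (QSpin.gibbs H β) Ω) m
      have h2 := QSpin.average_sub_pow_le hψ hG hd hα hgrow hξ hclus hℓ hrℓ hω (m := m) hpos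
      rw [← hΩ] at h2
      have h3 := h1.trans h2
      rw [inv_mul_le_iff₀ hZ0] at h3
      have hS := QSpin.momentScale_nonneg (d := d) (ξ := ξ) (n := Fintype.card V) (ℓ := ℓ) (m := m) hα
      refine (QSpin.shellDistribution_real_le hβ hcard hx₀ (by positivity) h3 hZ).trans ?_
      have h4 := QSpin.momentScale_div_sq_le hd hα hξ hn0 hℓ hx₀ (hm.trans (min_le_left _ _))
        (hm.trans (min_le_right _ _))
      have h5 : Real.exp (-(m : ℝ)) = Real.exp (-1) ^ m := by
        rw [← Real.exp_nat_mul]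
        ring_nf
      rw [h5, pow_mul, mul_div_assoc, ← div_pow, ← mul_assoc, mul_comm Q]
      gcongr
  refine hmain.trans ?_
  have hQ0 : 0 ≤ 3 * Q := by positivity
  refine (mul_le_mul_of_nonneg_left QSpin.exp_neg_floor_min_le hQ0).trans ?_
  rw [← mul_assoc, hQ', QSpin.CDelta]
  refine mul_le_mul_of_nonneg_right ?_ (le_max_of_le_left (Real.exp_pos _).le)
  -- Rounding `m` costs only `e`; the summand `3 * e * ξ` is slack.
  have he : Real.exp 1 ≤ Real.exp 1 + 3 * Real.exp 1 * ξ := by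
    have := Real.exp_pos 1
    nlinarith [mul_pos this hξ]
  rw [mul_right_comm]
  gcongr
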